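/- **Setting.** Let $\pi=(n_1,\ldots,n_m)$ be a partition of $n$, i.e. $n_1,\ldots,n_m\ge 1$ and $n_1+\cdots+n_m=n$, and let matrices $A=(A_{rs})\in\mathbb{C}^{n\times n}$ carry the corresponding block partition, $A_{rs}\in\mathbb{C}^{n_r\times n_s}$. *Orderings.* Let $\mathcal{P}_m=\{(r,s): 1\le r<s\le m\}$ and $M=m(m-1)/2$. A pivot ordering is a sequence in which each element of $\mathcal{P}_m$ appears exactly once. Write $\mathcal{O}\sim\mathcal{O}'$ if $\mathcal{O}'$ arises from $\mathcal{O}$ by finitely many transpositions of adjacent terms $(i,j),(k,l)$ with $\{i,j\}\cap\{k,l\}=\emptyset$; call $\mathcal{O},\mathcal{O}'$ shift equivalent if $\mathcal{O}=[\mathcal{O}_1,\mathcal{O}_2]$, $\mathcal{O}'=[\mathcal{O}_2,\mathcal{O}_1]$; weakly equivalent ($\stackrel{\mathsf w}{\sim}$) if they are joined by a finite chain whose links are equivalences $\sim$ or shift equivalences; and permutation equivalent ($\stackrel{\mathsf p}{\sim}$) if $\mathcal{O}'$ arises from $\mathcal{O}$ by replacing each pair $(i,j)$ by the pair $\mathsf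 q(i),\mathsf q(j)$, written in increasing order, for one permutation $\mathsf q$ of $\{1,\ldots,m\}$. Let $\mathcal{B}_c^{(m)}$ be the set of orderings that run through the columns $2,3,\ldots,m$ in this order, listing the pairs $(1,j),\ldots,(j-1,j)$ of column $j$ in arbitrary order, and $\mathcal{B}_r^{(m)}$ the set of those that run through the rows $m-1,m-2,\ldots,1$ in this order, listing the pairs $(i,i+1),\ldots,(i,m)$ of row $i$ in arbitrary order. Let $\mathcal{B}_{sp}^{(m)}$ consist of the elements of $\mathcal{B}_c^{(m)}\cup\mathcal{B}_r^{(m)}$ and their reversals. A chain in canonical form from $\mathcal{O}$ to $\mathcal{O}''$ is $\mathcal{O}\stackrel{\mathsf p}{\sim}\mathcal{O}'\stackrel{\mathsf w}{\sim}\mathcal{O}''$ or $\mathcal{O}\stackrel{\mathsf w}{\sim}\mathcal{O}'\stackrel{\mathsf p}{\sim}\mathcal{O}''$; it contains $d$ shift equivalences if $d$ of the links of the chain that realizes $\stackrel{\mathsf w}{\sim}$ are shift equivalences, the other links being equivalences $\sim$. Let $\mathcal{B}_{sg}^{(m)}$ be the set of pivot orderings joined to some $\mathcal{O}''\in\mathcal{B}_{sp}^{(m)}$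 by a chain in canonical form. *Transformations.* For $0<\varrho\le 1$ and $(i,j)\in\mathcal{P}_m$, a unitary $U\in\mathbb{C}^{n\times n}$ is of class $\mathrm{UBCE}_\pi(\varrho)$ with pivot pair $(i,j)$ if it agrees with $I_n$ outside the blocks $(i,i),(i,j),(j,i),(j,j)$ and $$\sigma_{\min}(U_{ii})=\sigma_{\min}(U_{jj})\ge\varrho\,\gamma_{ij},\qquad \gamma_{ij}=\max\left\{\frac{3}{\sqrt{(n_j+1)(4^{n_i}+6n_j-1)}},\ \binom{n_i+n_j}{n_i}^{-1/2}\right\}.$$ *Operators.* Let $\mathrm{vec}(A)\in\mathbb{C}^{2K}$, $2K=n^2-\sum_r n_r^2$, be the vector of all entries of the off-diagonal blocks of $A$ in a fixed order, and let $\mathcal{N}_{ij}$ set the blocks $(i,j)$ and $(j,i)$ of a matrix to zero. For $U$ of class $\mathrm{UBCE}_\pi(\varrho)$ with pivot pair $(i,j)$, the block Jacobi annihilator is the $2K\times 2K$ matrix $\mathcal{R}_{ij}$ with $\mathcal{R}_{ij}\,\mathrm{vec}(A)=\mathrm{vec}(\mathcal{N}_{ij}(U^*AU))$ for all $A\in\mathbb{C}^{n\times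 n}$. For a pivot ordering $\mathcal{O}=(i_0,j_0),\ldots,(i_{M-1},j_{M-1})$, let $\mathcal{J}_{\mathcal{O}}^{\mathrm{UBCE}_\pi(\varrho)}$ be the set of all products $\mathcal{R}_{i_{M-1}j_{M-1}}\cdots\mathcal{R}_{i_1j_1}\mathcal{R}_{i_0j_0}$ of such annihilators (the transformations being chosen independently). **Theorem.** There are constants $\mu_{\pi,\varrho}$, depending only on $\pi$ and $\varrho$, and $\widetilde{\mu}_{n,\varrho}$, depending only on $n$ and $\varrho$, such that for every $n$, every partition $\pi=(n_1,\ldots,n_m)$ of $n$ and every $0<\varrho\le 1$, $$0\le\mu_{\pi,\varrho}<\widetilde{\mu}_{n,\varrho}<1,$$ and the following holds: if $\mathcal{O}\in\mathcal{B}_{sg}^{(m)}$ is joined to some $\mathcal{O}''\in\mathcal{B}_{sp}^{(m)}$ by a chain in canonical form that contains $d$ shift equivalences, and $\mathcal{J}_1,\ldots,\mathcal{J}_{d+1}\in\mathcal{J}_{\mathcal{O}}^{\mathrm{UBCE}_\pi(\varrho)}$ are arbitrary, then in the spectral norm $$\|\mathcal{J}_{d+1}\cdots\mathcal{J}_2\mathcal{J}_1\|_2\le\mu_{\pi,\varrho}.$$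 -/

import Mathlib

open scoped Matrix Matrix.Norms.L2Operator

namespace BlockJacobi

/-! ### Pivot orderings

Block indices are `0, …, m - 1`; an element of `P_m` is a pair `(i, j)` with `i < j`. -/

/-- `O` is a pivot ordering: a sequence in which every element of `P_m` appears exactly once. -/
def IsPivotOrdering {m : ℕ} (O : List (Fin m × Fin m)) : Prop :=
  O.Nodup ∧ ∀ p : Fin m × Fin m, p ∈ O ↔ p.1 < p.2

/-- The index sets of two pivot pairs are disjoint. -/
def DisjointPairs {m : ℕ} (p q : Fin m × Fin m) : Prop :=
  p.1 ≠ q.1 ∧ p.1 ≠ q.2 ∧ p.2 ≠ q.1 ∧ p.2 ≠ q.2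

/-- `O'` arises from `O` by one admissible transposition. -/
def AdmissibleTransposition {m : ℕ} (O O' : List (Fin m × Fin m)) : Prop :=
  ∃ (l₁ l₂ : List (Fin m × Fin m)) (p q : Fin m × Fin m), DisjointPairs p q ∧
    O = l₁ ++ p :: q :: l₂ ∧ O' = l₁ ++ q :: p :: l₂

/-- `O ∼ O'`: finitely many admissible transpositions lead from `O` to `O'`. -/
def Equivalent {m : ℕ} (O O' : List (Fin m × Fin m)) : Prop :=
  Relation.ReflTransGen AdmissibleTransposition O O'

/-- Shift equivalence. -/
def ShiftEquivalent {m : ℕ} (O O' : List (Fin m × Fin m)) : Prop :=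
  ∃ O₁ O₂ : List (Fin m × Fin m), O = O₁ ++ O₂ ∧ O' = O₂ ++ O₁

/-- `WeakChain d O O'`: a finite chain leads from `O` to `O'`, each of whose links is an
equivalence `∼` or a shift equivalence, with exactly `d` links of the second kind. -/
inductive WeakChain {m : ℕ} : ℕ → List (Fin m × Fin m) → List (Fin m × Fin m) → Prop
  | nil (O : List (Fin m × Fin m)) : WeakChain 0 O O
  | equiv {d : ℕ} {O O' O'' : List (Fin m × Fin m)} :
      Equivalent O O' → WeakChain d O' O'' → WeakChain d O O''
  | shift {d : ℕ} {O O' O'' : List (Fin m × Fin m)} :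
      ShiftEquivalent O O' → WeakChain d O' O'' → WeakChain (d + 1) O O''

/-- The pivot position given by two block indices in any order. -/
def sortPair {m : ℕ} (r s : Fin m) : Fin m × Fin m := (min r s, max r s)

/-- Permutation equivalence, `O' = O(q)`. -/
def PermEquivalent {m : ℕ} (O O' : List (Fin m × Fin m)) : Prop :=
  ∃ q : Equiv.Perm (Fin m), O' = O.map fun p => sortPair (q p.1) (q p.2)

/-- `O` and `O''` are connected by a chain in canonical form that contains `d` shift
equivalences. -/
def CanonicalChain {m : ℕ} (d : ℕ) (O O'' : List (Fin m × Fin m)) : Prop :=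
  (∃ O', PermEquivalent O O' ∧ WeakChain d O' O'') ∨
    ∃ O', WeakChain d O O' ∧ PermEquivalent O' O''

/-- The class `B_c`: column by column from left to right, in any order inside each column. -/
def colOrderings (m : ℕ) : Set (List (Fin m × Fin m)) :=
  {O | ∃ L : Fin m → List (Fin m),
    (∀ j, (L j).Perm ((List.finRange m).filter fun i => i < j)) ∧
      O = (List.finRange m).flatMap fun j => (L j).map fun i => (i, j)}

/-- The class `B_r`: row by row from bottom to top, in any order inside each row. -/
def rowOrderings (m : ℕ) : Set (List (Fin m × Fin m)) :=
  {O | ∃ L : Fin m → List (Fin m),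
    (∀ i, (L i).Perm ((List.finRange m).filter fun j => i < j)) ∧
      O = (List.finRange m).reverse.flatMap fun i => (L i).map fun j => (i, j)}

/-- The class `B_sp` of serial orderings with permutations. -/
def serialOrderings (m : ℕ) : Set (List (Fin m × Fin m)) :=
  {O | O ∈ colOrderings m ∨ O.reverse ∈ colOrderings m ∨
    O ∈ rowOrderings m ∨ O.reverse ∈ rowOrderings m}

/-- The class `B_sg` of generalized serial orderings. -/
def generalizedSerialOrderings (m : ℕ) : Set (List (Fin m × Fin m)) :=
  {O | IsPivotOrdering O ∧ ∃ O'' ∈ serialOrderings m, ∃ d, CanonicalChain d O O''}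

/-! ### Block matrices

A partition `π = (n_1, …, n_m)` of `n` into positive parts is a `Composition n`. -/

/-- The row and column positions `1, …, n`, listed block by block
(`Composition.blocksFinEquiv` identifies them with `Fin n`). -/
abbrev Pos {n : ℕ} (π : Composition n) : Type := Σ i : Fin π.length, Fin (π.blocksFun i)

/-- The `(r, s)` block of a matrix. -/
def block {n : ℕ} {π : Composition n} (A : Matrix (Pos π) (Pos π) ℂ) (r s : Fin π.length) :
    Matrix (Fin (π.blocksFun r)) (Fin (π.blocksFun s)) ℂ :=
  Matrix.of fun x y => A ⟨r, x⟩ ⟨s, y⟩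

/-- `U` agrees with the identity outside the blocks `(i, i)`, `(i, j)`, `(j, i)`, `(j, j)`. -/
def IsElementary {n : ℕ} {π : Composition n} (i j : Fin π.length)
    (U : Matrix (Pos π) (Pos π) ℂ) : Prop :=
  ∀ s t : Pos π, ¬ ((s.1 = i ∨ s.1 = j) ∧ (t.1 = i ∨ t.1 = j)) →
    U s t = (1 : Matrix (Pos π) (Pos π) ℂ) s t

/-- The smallest singular value of a square matrix of order `p ≥ 1`
(`LinearMap.singularValues` is decreasing and indexed from `0`). -/
noncomputable def sigmaMin {p : ℕ} (X : Matrix (Fin p) (Fin p) ℂ) : ℝ :=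
  (Matrix.toEuclideanLin X).singularValues (p - 1)

/-- The constant `γ_ij`, as a function of `a = n_i` and `b = n_j`. -/
noncomputable def gammaConst (a b : ℕ) : ℝ :=
  max (3 / √(((b : ℝ) + 1) * ((4 : ℝ) ^ a + 6 * (b : ℝ) - 1))) (1 / √((a + b).choose a : ℝ))

/-- The unitary elementary UBC block matrices of the class `UBCE_π(ρ)` with pivot pair `(i, j)`. -/
def ubce {n : ℕ} (π : Composition n) (ρ : ℝ) (i j : Fin π.length) :
    Set (Matrix (Pos π) (Pos π) ℂ) :=
  {U | U ∈ Matrix.unitaryGroup (Pos π) ℂ ∧ IsElementary i j U ∧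
    sigmaMin (block U i i) = sigmaMin (block U j j) ∧
    ρ * gammaConst (π.blocksFun i) (π.blocksFun j) ≤ sigmaMin (block U i i)}

/-! ### Block Jacobi annihilators and operators -/

/-- The positions of the entries of all off-diagonal blocks; they index the `2K` coordinates of
the vector of a block matrix. -/
abbrev OffPos {n : ℕ} (π : Composition n) : Type :=
  {p : Pos π × Pos π // p.1.1 ≠ p.2.1}

/-- The vector of all entries of the off-diagonal blocks. -/
def vec {n : ℕ} {π : Composition n} (A : Matrix (Pos π) (Pos π) ℂ) : OffPos π → ℂ :=
  fun p => A p.1.1 p.1.2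

/-- The inverse of the restriction of `vec` to the matrices with zero diagonal blocks. -/
def unvec {n : ℕ} {π : Composition n} (a : OffPos π → ℂ) : Matrix (Pos π) (Pos π) ℂ :=
  Matrix.of fun s t => if h : s.1 ≠ t.1 then a ⟨(s, t), h⟩ else 0

/-- The operator `N_ij` that sets the blocks `(i, j)` and `(j, i)` to zero. -/
def killBlocks {n : ℕ} {π : Composition n} (i j : Fin π.length)
    (A : Matrix (Pos π) (Pos π) ℂ) : Matrix (Pos π) (Pos π) ℂ :=
  Matrix.of fun s t => if (s.1 = i ∧ t.1 = j) ∨ (s.1 = j ∧ t.1 = i) then 0 else A s t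

/-- The linear map `a ↦ vec (N_ij (U^* vec₀⁻¹(a) U))`. -/
def annihilatorMap {n : ℕ} {π : Composition n} (i j : Fin π.length)
    (U : Matrix (Pos π) (Pos π) ℂ) : (OffPos π → ℂ) →ₗ[ℂ] (OffPos π → ℂ) where
  toFun a := vec (killBlocks i j (Uᴴ * unvec a * U))
  map_add' a b := by
    have h : unvec (a + b) = unvec a + unvec b := by
      ext s t
      by_cases hst : s.1 = t.1 <;> simp [unvec, hst]
    rw [h, Matrix.mul_add, Matrix.add_mul]
    ext p
    simp only [vec, killBlocks, Matrix.of_apply, Matrix.add_apply, Pi.add_apply]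
    split_ifs <;> simp
  map_smul' c a := by
    have h : unvec (c • a) = c • unvec a := by
      ext s t
      by_cases hst : s.1 = t.1 <;> simp [unvec, hst]
    rw [h, Matrix.mul_smul, Matrix.smul_mul]
    ext p
    simp only [vec, killBlocks, Matrix.of_apply, Matrix.smul_apply, Pi.smul_apply,
      RingHom.id_apply]
    split_ifs <;> simp

/-- The complex `ij`-block Jacobi annihilator, a matrix of order `2K`. -/
def annihilator {n : ℕ} {π : Composition n} (i j : Fin π.length)
    (U : Matrix (Pos π) (Pos π) ℂ) : Matrix (OffPos π) (OffPos π) ℂ :=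
  LinearMap.toMatrix' (annihilatorMap i j U)

/-- For elementary `U` the annihilator maps `vec A` to `vec (N_ij (U^* A U))` for every matrix `A`,
also when the diagonal blocks of `A` are not zero. -/
theorem annihilator_mulVec_vec {n : ℕ} {π : Composition n} (i j : Fin π.length)
    (U : Matrix (Pos π) (Pos π) ℂ) (hU : IsElementary i j U) (A : Matrix (Pos π) (Pos π) ℂ) :
    annihilator i j U *ᵥ vec A = vec (killBlocks i j (Uᴴ * A * U)) := by
  have h0 : ∀ s t : Pos π, s.1 ≠ t.1 →
      ¬ ((s.1 = i ∧ t.1 = j) ∨ (s.1 = j ∧ t.1 = i)) →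
      (Uᴴ * (A - unvec (vec A)) * U) s t = 0 := by
    intro s t hst hk
    simp only [Matrix.mul_apply, Finset.sum_mul]
    refine Finset.sum_eq_zero fun y _ => Finset.sum_eq_zero fun x _ => ?_
    by_cases hxy : x.1 = y.1
    · by_cases hs : (x.1 = i ∨ x.1 = j) ∧ (s.1 = i ∨ s.1 = j)
      · have ht : ¬ ((y.1 = i ∨ y.1 = j) ∧ (t.1 = i ∨ t.1 = j)) := by grind
        have hyt : y ≠ t := by rintro rfl; grind
        rw [hU y t ht, Matrix.one_apply_ne hyt, mul_zero]
      · by_cases hxs : x = s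
        · subst hxs
          have ht : ¬ ((y.1 = i ∨ y.1 = j) ∧ (t.1 = i ∨ t.1 = j)) := by grind
          have hyt : y ≠ t := by rintro rfl; exact hst hxy
          rw [hU y t ht, Matrix.one_apply_ne hyt, mul_zero]
        · rw [Matrix.conjTranspose_apply, hU x s hs, Matrix.one_apply_ne hxs]
          simp
    · simp [unvec, vec, hxy]
  rw [annihilator, LinearMap.toMatrix'_mulVec]
  ext p
  have h1 := h0 p.1.1 p.1.2 p.2
  simp only [annihilatorMap, LinearMap.coe_mk, AddHom.coe_mk, vec, killBlocks, Matrix.of_apply]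
  split_ifs with hk
  · rfl
  · have h2 := h1 hk
    rw [Matrix.mul_sub, Matrix.sub_mul, Matrix.sub_apply, sub_eq_zero] at h2
    exact h2.symm

/-- The annihilators with pivot pair `(i, j)` whose transformation is in `UBCE_π(ρ)`. -/
def ubceAnnihilators {n : ℕ} (π : Composition n) (ρ : ℝ) (i j : Fin π.length) :
    Set (Matrix (OffPos π) (OffPos π) ℂ) :=
  {R | ∃ U ∈ ubce π ρ i j, R = annihilator i j U}

/-- The block Jacobi operators `R_{M-1} ⋯ R_1 R_0` associated with the ordering `O`, all of whose
annihilators come from `UBCE_π(ρ)`. -/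
def ubceOperators {n : ℕ} (π : Composition n) (ρ : ℝ)
    (O : List (Fin π.length × Fin π.length)) : Set (Matrix (OffPos π) (OffPos π) ℂ) :=
  {J | ∃ Rs : List (Matrix (OffPos π) (OffPos π) ℂ),
    List.Forall₂ (fun p R => R ∈ ubceAnnihilators π ρ p.1 p.2) O Rs ∧ J = Rs.reverse.prod}

end BlockJacobi

namespace BlockJacobi

open scoped Pointwise

variable {n : ℕ} {π : Composition n}

/-! ### Elementary block matrices -/

/-! The constant comes from compactness, the strict contraction from a rigidity argument. An
annihilator is a unitary similarity followed by deleting entries, so it never increases the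
Euclidean norm. If a product of annihilators preserves the norm of a vector, no factor deletes
anything: the sweep is lossless, each step is a unitary similarity, and the pivot submatrix is zero
after the step and hence, by inverting the similarity, also before it.

For a column-wise ordering this forces the matrix to vanish. If the blocks of the earlier columns
are already zero and column `c` is swept without loss, nonsingularity of the diagonal pivot block
`U_cc` gives that row `c` was zero against those columns before the sweep
(`LosslessSweep.row_eq_zero`); conjugate transposition treats column `c`. By induction the final
matrix is zero, hence so is the initial one. Rows, reversals and relabellings reduce to this case
(`rigid_map_of_mem_serialOrderings`).

The UBC bound enters only through a positive lower bound on the determinants of the diagonal pivot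
blocks. This bound defines a compact class `detClass`, whose products of annihilators along a fixed
ordering form a compact set; a norm that drops strictly on every nonzero vector then drops uniformly
(`exists_norm_le_of_isCompact`).

Finally, annihilators with disjoint pivot pairs commute, and each shift equivalence costs one sweep,
so `d + 1` sweeps contain a full sweep of a relabelled serial ordering, flanked by contractions
(`WeakChain.products_pow_subset`). -/

theorem IsElementary.symm {i j : Fin π.length} {U : Matrix (Pos π) (Pos π) ℂ}
    (hU : IsElementary i j U) : IsElementary j i U := fun s t h =>
  hU s t fun h' => h ⟨h'.1.symm, h'.2.symm⟩

theorem IsElementary.conjTranspose {i j : Fin π.length} {U : Matrix (Pos π) (Pos π) ℂ}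
    (hU : IsElementary i j U) : IsElementary i j Uᴴ := by
  intro s t h
  rw [Matrix.conjTranspose_apply, hU t s fun h' => h h'.symm, ← Matrix.conjTranspose_apply,
    Matrix.conjTranspose_one]

theorem IsElementary.apply_eq_zero {i j : Fin π.length} {U : Matrix (Pos π) (Pos π) ℂ}
    (hU : IsElementary i j U) {s t : Pos π} (hst : s ≠ t)
    (h : ¬ ((s.1 = i ∨ s.1 = j) ∧ (t.1 = i ∨ t.1 = j))) : U s t = 0 := by
  rw [hU s t h, Matrix.one_apply_ne hst]

theorem IsElementary.mul_apply_of_notMem {i j : Fin π.length} {U : Matrix (Pos π) (Pos π) ℂ}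
    (hU : IsElementary i j U) (A : Matrix (Pos π) (Pos π) ℂ) (s : Pos π) {t : Pos π}
    (hi : t.1 ≠ i) (hj : t.1 ≠ j) : (A * U) s t = A s t := by
  rw [Matrix.mul_apply, Finset.sum_eq_single t]
  · rw [hU t t (by tauto), Matrix.one_apply_eq, mul_one]
  · intro x _ hx
    rw [hU.apply_eq_zero hx (by tauto), mul_zero]
  · simp

theorem IsElementary.conjTranspose_mul_apply_of_notMem {i j : Fin π.length}
    {U : Matrix (Pos π) (Pos π) ℂ} (hU : IsElementary i j U) (A : Matrix (Pos π) (Pos π) ℂ)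
    {s : Pos π} (t : Pos π) (hi : s.1 ≠ i) (hj : s.1 ≠ j) : (Uᴴ * A) s t = A s t := by
  have h := hU.mul_apply_of_notMem Aᴴ t hi hj
  rw [← Matrix.conjTranspose_conjTranspose A, ← Matrix.conjTranspose_mul,
    Matrix.conjTranspose_apply, h]
  simp

theorem IsElementary.conj_apply_of_notMem {i j : Fin π.length} {U : Matrix (Pos π) (Pos π) ℂ}
    (hU : IsElementary i j U) (A : Matrix (Pos π) (Pos π) ℂ) {s t : Pos π}
    (hs : s.1 ≠ i ∧ s.1 ≠ j) (ht : t.1 ≠ i ∧ t.1 ≠ j) : (Uᴴ * A * U) s t = A s t := by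
  rw [hU.mul_apply_of_notMem _ _ ht.1 ht.2, hU.conjTranspose_mul_apply_of_notMem _ _ hs.1 hs.2]

/-- A set of block indices that contains the pivot pair stays a zero principal submatrix. -/
theorem IsElementary.conj_apply_eq_zero {i j : Fin π.length} {U : Matrix (Pos π) (Pos π) ℂ}
    (hU : IsElementary i j U) {A : Matrix (Pos π) (Pos π) ℂ} {S : Fin π.length → Prop}
    (hi : S i) (hj : S j) (hA : ∀ s t : Pos π, S s.1 → S t.1 → A s t = 0) {s t : Pos π}
    (hs : S s.1) (ht : S t.1) : (Uᴴ * A * U) s t = 0 := by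
  have key : ∀ x y : Pos π, S y.1 → ¬ S x.1 → U x y = 0 := by
    intro x y hy hx
    refine hU.apply_eq_zero (by rintro rfl; exact hx hy) ?_
    rintro ⟨rfl | rfl, -⟩ <;> exact hx ‹_›
  simp only [Matrix.mul_apply, Finset.sum_mul, Matrix.conjTranspose_apply]
  refine Finset.sum_eq_zero fun y _ => Finset.sum_eq_zero fun x _ => ?_
  by_cases hx : S x.1
  · by_cases hy : S y.1
    · rw [hA x y hx hy, mul_zero, zero_mul]
    · rw [key y t ht hy, mul_zero]
  · rw [key x s hs hx, star_zero, zero_mul, zero_mul]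

/-! ### Norm-preserving sweeps -/

/-- `A` has zero diagonal blocks. -/
def ZeroDiag (A : Matrix (Pos π) (Pos π) ℂ) : Prop :=
  ∀ s t : Pos π, s.1 = t.1 → A s t = 0

/-- One step of a sweep in which nothing is annihilated: `A' = U^* A U` for an elementary unitary
`U` with nonsingular diagonal pivot blocks, and the pivot submatrix of `A'` is zero. -/
def LosslessStep (i j : Fin π.length) (A A' : Matrix (Pos π) (Pos π) ℂ) : Prop :=
  ∃ U ∈ Matrix.unitaryGroup (Pos π) ℂ, IsElementary i j U ∧
    (block U i i).det ≠ 0 ∧ (block U j j).det ≠ 0 ∧ A' = Uᴴ * A * U ∧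
    ∀ s t : Pos π, (s.1 = i ∨ s.1 = j) → (t.1 = i ∨ t.1 = j) → A' s t = 0

/-- A sweep along a list of pivot pairs in which nothing is annihilated. -/
def LosslessSweep : List (Fin π.length × Fin π.length) → Matrix (Pos π) (Pos π) ℂ →
    Matrix (Pos π) (Pos π) ℂ → Prop
  | [], A, A' => A = A'
  | p :: l, A, A' => ∃ B, LosslessStep p.1 p.2 A B ∧ LosslessSweep l B A'

theorem block_conjTranspose (U : Matrix (Pos π) (Pos π) ℂ) (r s : Fin π.length) :
    block Uᴴ r s = (block U s r)ᴴ := rfl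

theorem LosslessStep.swap {i j : Fin π.length} {A A' : Matrix (Pos π) (Pos π) ℂ}
    (h : LosslessStep i j A A') : LosslessStep j i A A' := by
  obtain ⟨U, hU, he, hi, hj, hA, h0⟩ := h
  exact ⟨U, hU, he.symm, hj, hi, hA, fun s t hs ht => h0 s t hs.symm ht.symm⟩

/-- `Uᴴ` undoes the step, and the pivot submatrix of `A = U A' Uᴴ` depends only on that of `A'`,
which is zero. -/
theorem LosslessStep.reverse {i j : Fin π.length} {A A' : Matrix (Pos π) (Pos π) ℂ}
    (h : LosslessStep i j A A') : LosslessStep i j A' A := by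
  obtain ⟨U, hU, he, hi, hj, hA, h0⟩ := h
  have hUU : U * Uᴴ = 1 := Unitary.mul_star_self_of_mem hU
  have hA' : A = Uᴴᴴ * A' * Uᴴ := by
    rw [hA, Matrix.conjTranspose_conjTranspose, Matrix.mul_assoc, Matrix.mul_assoc, hUU,
      Matrix.mul_one, ← Matrix.mul_assoc, hUU, Matrix.one_mul]
  refine ⟨Uᴴ, Unitary.star_mem hU, he.conjTranspose, ?_, ?_, hA', ?_⟩
  · rw [block_conjTranspose, Matrix.det_conjTranspose]
    exact star_ne_zero.2 hi
  · rw [block_conjTranspose, Matrix.det_conjTranspose]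
    exact star_ne_zero.2 hj
  · intro s t hs ht
    rw [hA']
    exact he.conjTranspose.conj_apply_eq_zero (S := fun r => r = i ∨ r = j) (Or.inl rfl)
      (Or.inr rfl) h0 hs ht

theorem LosslessStep.conjTranspose {i j : Fin π.length} {A A' : Matrix (Pos π) (Pos π) ℂ}
    (h : LosslessStep i j A A') : LosslessStep i j Aᴴ A'ᴴ := by
  obtain ⟨U, hU, he, hi, hj, hA, h0⟩ := h
  refine ⟨U, hU, he, hi, hj, ?_, fun s t hs ht => ?_⟩
  · rw [hA, Matrix.conjTranspose_mul, Matrix.conjTranspose_mul,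
      Matrix.conjTranspose_conjTranspose, Matrix.mul_assoc]
  · rw [Matrix.conjTranspose_apply, h0 t s ht hs, star_zero]

theorem LosslessStep.zeroDiag {i j : Fin π.length} {A A' : Matrix (Pos π) (Pos π) ℂ}
    (h : LosslessStep i j A A') (hA : ZeroDiag A) : ZeroDiag A' := by
  obtain ⟨U, hU, he, hi, hj, rfl, h0⟩ := h
  intro s t hst
  by_cases hs : s.1 = i ∨ s.1 = j
  · exact h0 s t hs (hst ▸ hs)
  · rw [he.conj_apply_of_notMem A (not_or.1 hs) (not_or.1 (hst ▸ hs))]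
    exact hA s t hst

theorem losslessSweep_append {l₁ l₂ : List (Fin π.length × Fin π.length)}
    {A A' : Matrix (Pos π) (Pos π) ℂ} :
    LosslessSweep (l₁ ++ l₂) A A' ↔ ∃ B, LosslessSweep l₁ A B ∧ LosslessSweep l₂ B A' := by
  induction l₁ generalizing A with
  | nil => simp [LosslessSweep]
  | cons p l ih =>
    simp only [List.cons_append, LosslessSweep, ih]
    constructor
    · rintro ⟨B, hB, C, hC, h⟩
      exact ⟨C, ⟨B, hB, hC⟩, h⟩
    · rintro ⟨C, ⟨B, hB, hC⟩, h⟩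
      exact ⟨B, hB, C, hC, h⟩

theorem LosslessSweep.reverse {l : List (Fin π.length × Fin π.length)}
    {A A' : Matrix (Pos π) (Pos π) ℂ} (h : LosslessSweep l A A') :
    LosslessSweep l.reverse A' A := by
  induction l generalizing A with
  | nil => exact h.symm
  | cons p l ih =>
    obtain ⟨B, hB, h⟩ := h
    rw [List.reverse_cons, losslessSweep_append]
    exact ⟨B, ih h, A, hB.reverse, rfl⟩

theorem LosslessSweep.conjTranspose {l : List (Fin π.length × Fin π.length)}
    {A A' : Matrix (Pos π) (Pos π) ℂ} (h : LosslessSweep l A A') :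
    LosslessSweep l Aᴴ A'ᴴ := by
  induction l generalizing A with
  | nil => exact congrArg _ h
  | cons p l ih =>
    obtain ⟨B, hB, h⟩ := h
    exact ⟨Bᴴ, hB.conjTranspose, ih h⟩

theorem LosslessSweep.zeroDiag {l : List (Fin π.length × Fin π.length)}
    {A A' : Matrix (Pos π) (Pos π) ℂ} (h : LosslessSweep l A A') (hA : ZeroDiag A) :
    ZeroDiag A' := by
  induction l generalizing A with
  | nil => exact h ▸ hA
  | cons p l ih =>
    obtain ⟨B, hB, h⟩ := h
    exact ih h (hB.zeroDiag hA)

theorem LosslessSweep.apply_eq_zero {l : List (Fin π.length × Fin π.length)}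
    {A A' : Matrix (Pos π) (Pos π) ℂ} (h : LosslessSweep l A A') {S : Fin π.length → Prop}
    (hl : ∀ p ∈ l, S p.1 ∧ S p.2) (hA : ∀ s t : Pos π, S s.1 → S t.1 → A s t = 0) :
    ∀ s t : Pos π, S s.1 → S t.1 → A' s t = 0 := by
  induction l generalizing A with
  | nil => exact h ▸ hA
  | cons p l ih =>
    obtain ⟨B, ⟨U, -, he, -, -, rfl, -⟩, h⟩ := h
    have hp := hl p List.mem_cons_self
    exact ih h (fun q hq => hl q (List.mem_cons_of_mem _ hq))
      fun s t hs ht => he.conj_apply_eq_zero hp.1 hp.2 hA hs ht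

/-- The order of the two indices of a pivot pair is irrelevant. -/
theorem LosslessSweep.of_map {α : Type*} {f g : α → Fin π.length × Fin π.length}
    (hfg : ∀ x, f x = g x ∨ f x = (g x).swap) {l : List α}
    {A A' : Matrix (Pos π) (Pos π) ℂ} (h : LosslessSweep (l.map f) A A') :
    LosslessSweep (l.map g) A A' := by
  induction l generalizing A with
  | nil => exact h
  | cons x l ih =>
    obtain ⟨B, hB, h⟩ := h
    refine ⟨B, ?_, ih h⟩
    rcases hfg x with hx | hx
    · exact hx ▸ hB
    · rw [hx] at hB
      exact hB.swap

/-- One column of a lossless sweep: row `c` was zero at the positions that are visited. -/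
theorem LosslessSweep.row_eq_zero {c : Fin π.length} {L : List (Fin π.length)}
    (hL : L.Nodup) (hc : c ∉ L) {A A' : Matrix (Pos π) (Pos π) ℂ}
    (h : LosslessSweep (L.map fun i => (i, c)) A A')
    (hA : ∀ s t : Pos π, s.1 ∈ L → t.1 ∈ L → A s t = 0) :
    ∀ s t : Pos π, s.1 = c → t.1 ∈ L → A s t = 0 := by
  induction L generalizing A with
  | nil => simp
  | cons i L ih =>
    obtain ⟨B, hB, h⟩ := h
    have hrev := hB.reverse
    obtain ⟨U, -, he, -, hdet, rfl, h0⟩ := hB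
    rw [List.nodup_cons] at hL
    rw [List.mem_cons, not_or] at hc
    have hLi : ∀ t : Pos π, t.1 ∈ L → t.1 ≠ i ∧ t.1 ≠ c := fun t ht =>
      ⟨fun e => hL.1 (e ▸ ht), fun e => hc.2 (e ▸ ht)⟩
    -- The step with pivot `(i, c)` does not touch the blocks indexed by the rest of the list, so
    -- the hypothesis on `A` passes to `B`.
    have hB0 := ih hL.2 hc.2 h fun s t hs ht => by
      rw [he.conj_apply_of_notMem A (hLi s hs) (hLi t ht)]
      exact hA s t (List.mem_cons_of_mem _ hs) (List.mem_cons_of_mem _ ht)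
    rintro ⟨_, s⟩ t rfl ht
    rcases List.mem_cons.1 ht with hti | htL
    -- Block `(c, i)` lies in the pivot submatrix of the first step, which is zero before that step.
    · obtain ⟨V, -, -, -, -, -, hV⟩ := hrev
      exact hV _ _ (Or.inr rfl) (Or.inl hti)
    · rename_i c
      -- In row `c` of `Uᴴ A`, only the blocks `r = c` and `r = i` contribute, and the latter meets
      -- a zero block of `A`. Hence `U_ccᴴ A_ct = B_ct = 0`.
      have hz : (block U c c)ᴴ *ᵥ (fun x => A ⟨c, x⟩ t) = 0 := by
        funext y
        have hy := hB0 ⟨c, y⟩ t rfl htL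
        rw [he.mul_apply_of_notMem _ _ (hLi t htL).1 (hLi t htL).2, Matrix.mul_apply,
          Fintype.sum_sigma, Finset.sum_eq_single c] at hy
        · exact hy
        · intro r _ hr
          refine Finset.sum_eq_zero fun x _ => ?_
          by_cases hri : r = i
          · rw [hA ⟨r, x⟩ t (by simp [hri]) ht, mul_zero]
          · rw [Matrix.conjTranspose_apply, he.apply_eq_zero (by rintro ⟨⟩; exact hr rfl)
              (by tauto), star_zero, zero_mul]
        · simp
      have hd : (block U c c)ᴴ.det ≠ 0 := by
        rw [Matrix.det_conjTranspose]
        exact star_ne_zero.2 hdet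
      exact congrFun (Matrix.eq_zero_of_mulVec_eq_zero hd hz) s

theorem LosslessSweep.cross_eq_zero {c : Fin π.length} {L : List (Fin π.length)}
    (hL : L.Nodup) (hc : c ∉ L) {A A' : Matrix (Pos π) (Pos π) ℂ}
    (h : LosslessSweep (L.map fun i => (i, c)) A A') (hdiag : ZeroDiag A)
    (hA : ∀ s t : Pos π, s.1 ∈ L → t.1 ∈ L → A s t = 0) :
    ∀ s t : Pos π, (s.1 = c ∨ s.1 ∈ L) → (t.1 = c ∨ t.1 ∈ L) → A s t = 0 := by
  have hcol : ∀ s t : Pos π, s.1 ∈ L → t.1 = c → A s t = 0 := by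
    intro s t hs ht
    have := h.conjTranspose.row_eq_zero hL hc (fun s t hs ht => by
      rw [Matrix.conjTranspose_apply, hA t s ht hs, star_zero]) t s ht hs
    rwa [Matrix.conjTranspose_apply, star_eq_zero] at this
  rintro s t (hs | hs) (ht | ht)
  · exact hdiag s t (hs.trans ht.symm)
  · exact h.row_eq_zero hL hc hA s t hs ht
  · exact hcol s t hs ht
  · exact hA s t hs ht

/-- A lossless sweep through columns, each of which visits exactly the earlier columns, ends with
a matrix that is zero on all blocks of the columns visited. -/
theorem LosslessSweep.columns_eq_zero {α : Type*} {q : α → Fin π.length}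
    (hq : Function.Injective q) {C : List α} (hC : C.Nodup) {L : α → List α}
    (hL : ∀ C₁ c C₂, C = C₁ ++ c :: C₂ → (L c).Nodup ∧ ∀ i, i ∈ L c ↔ i ∈ C₁)
    {A A' : Matrix (Pos π) (Pos π) ℂ}
    (h : LosslessSweep (C.flatMap fun c => (L c).map fun i => (q i, q c)) A A')
    (hdiag : ZeroDiag A) :
    ∀ s t : Pos π, s.1 ∈ C.map q → t.1 ∈ C.map q → A' s t = 0 := by
  induction C using List.reverseRecOn generalizing A' with
  | nil => simp
  | append_singleton C c ih =>
    rw [List.flatMap_append, losslessSweep_append] at h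
    obtain ⟨B, hB, h⟩ := h
    rw [List.flatMap_singleton] at h
    obtain ⟨hn, hm⟩ := hL C c [] rfl
    have hcC : c ∉ C := by
      rw [List.nodup_append] at hC
      exact fun hc => hC.2.2 c hc c (by simp) rfl
    have hB0 := ih (hC.sublist (List.sublist_append_left _ _))
      (fun C₁ d C₂ e => hL C₁ d (C₂ ++ [c]) (by simp [e])) hB
    have hmem : ∀ r, r ∈ (L c).map q ↔ r ∈ C.map q := fun r => by simp [hm]
    have h' : LosslessSweep (((L c).map q).map fun i => (i, q c)) B A' := by
      rw [List.map_map]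
      exact h
    -- The blocks of column `c` and all earlier ones vanish before column `c` is swept; since its
    -- pivots stay inside this index set, they also vanish afterwards.
    have h0 := h'.cross_eq_zero (hn.map hq)
      (by rw [hmem, List.mem_map_of_injective hq]; exact hcC) (hB.zeroDiag hdiag)
      fun s t hs ht => hB0 s t ((hmem _).1 hs) ((hmem _).1 ht)
    have h1 := h'.apply_eq_zero (S := fun r => r = q c ∨ r ∈ (L c).map q)
      (fun p hp => by
        obtain ⟨i, hi, rfl⟩ := List.mem_map.1 hp
        exact ⟨Or.inr hi, Or.inl rfl⟩) h0
    intro s t hs ht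
    refine h1 s t ?_ ?_
    · rw [hmem]; simpa [or_comm] using hs
    · rw [hmem]; simpa [or_comm] using ht

/-- An ordering is rigid if no nonzero matrix with zero diagonal blocks admits a lossless sweep. -/
def Rigid (O : List (Fin π.length × Fin π.length)) : Prop :=
  ∀ A A' : Matrix (Pos π) (Pos π) ℂ, LosslessSweep O A A' → ZeroDiag A → A = 0

/-- The reversed sweep applies unitary similarities to the zero matrix. -/
theorem LosslessSweep.eq_zero {l : List (Fin π.length × Fin π.length)}
    {A : Matrix (Pos π) (Pos π) ℂ} (h : LosslessSweep l A 0) : A = 0 := by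
  have := h.reverse.apply_eq_zero (S := fun _ => True) (by simp) (by simp)
  ext s t
  exact this s t trivial trivial

theorem LosslessSweep.eq_zero_of_columns {q : Equiv.Perm (Fin π.length)}
    {C : List (Fin π.length)} (hC : C.Nodup) (hmem : ∀ r, r ∈ C)
    {L : Fin π.length → List (Fin π.length)}
    (hL : ∀ C₁ c C₂, C = C₁ ++ c :: C₂ → (L c).Nodup ∧ ∀ i, i ∈ L c ↔ i ∈ C₁)
    {A A' : Matrix (Pos π) (Pos π) ℂ}
    (h : LosslessSweep (C.flatMap fun c => (L c).map fun i => (q i, q c)) A A')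
    (hdiag : ZeroDiag A) : A = 0 := by
  have h0 := h.columns_eq_zero q.injective hC hL hdiag
  have hall : ∀ r, r ∈ C.map q := fun r => List.mem_map.2 ⟨q.symm r, hmem _, by simp⟩
  have : A' = 0 := by
    ext s t
    exact h0 s t (hall _) (hall _)
  exact (this ▸ h).eq_zero

theorem Rigid.of_reverse {O : List (Fin π.length × Fin π.length)} (h : Rigid O.reverse) :
    Rigid O := by
  intro A A' hs hd
  obtain rfl := h A' A hs.reverse (hs.zeroDiag hd)
  exact hs.eq_zero

/-! ### Rigidity of the serial orderings -/

theorem mem_iff_lt_of_finRange_eq_append {m : ℕ} {C₁ C₂ : List (Fin m)} {c : Fin m}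
    (h : List.finRange m = C₁ ++ c :: C₂) (i : Fin m) : i ∈ C₁ ↔ i < c := by
  have hp := List.pairwise_lt_finRange m
  have hi := List.mem_finRange i
  rw [h] at hi hp
  rw [List.pairwise_append, List.pairwise_cons] at hp
  refine ⟨fun h1 => hp.2.2 i h1 c (by simp), fun hlt => ?_⟩
  rw [List.mem_append, List.mem_cons] at hi
  rcases hi with hi | rfl | hi
  · exact hi
  · exact absurd hlt (lt_irrefl _)
  · exact absurd (hp.2.1.1 i hi) hlt.asymm

theorem mem_iff_gt_of_reverse_finRange_eq_append {m : ℕ} {C₁ C₂ : List (Fin m)} {c : Fin m}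
    (h : (List.finRange m).reverse = C₁ ++ c :: C₂) (i : Fin m) : i ∈ C₁ ↔ c < i := by
  have h' : List.finRange m = C₂.reverse ++ c :: C₁.reverse := by
    rw [← List.reverse_reverse (List.finRange m), h]
    simp
  have hp := List.pairwise_lt_finRange m
  have hi := List.mem_finRange i
  rw [h'] at hi hp
  rw [List.pairwise_append, List.pairwise_cons] at hp
  refine ⟨fun h1 => hp.2.1.1 i (by simpa using h1), fun hlt => ?_⟩
  rw [List.mem_append, List.mem_cons] at hi
  rcases hi with hi | rfl | hi
  · exact absurd (hp.2.2 i hi c (by simp)) hlt.asymm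
  · exact absurd hlt (lt_irrefl _)
  · simpa using hi

theorem sortPair_eq_or {m : ℕ} (r s : Fin m) : sortPair r s = (r, s) ∨ sortPair r s = (s, r) := by
  rcases le_total r s with h | h <;> simp [sortPair, h]

theorem rigid_map_of_mem_colOrderings (q : Equiv.Perm (Fin π.length))
    {O : List (Fin π.length × Fin π.length)} (hO : O ∈ colOrderings π.length) :
    Rigid (O.map fun p => sortPair (q p.1) (q p.2)) := by
  obtain ⟨L, hL, rfl⟩ := hO
  intro A A' h hd
  replace h := h.of_map (g := fun p : Fin π.length × Fin π.length => (q p.1, q p.2)) fun p => sortPair_eq_or _ _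
  rw [List.map_flatMap] at h
  simp only [List.map_map, Function.comp_def] at h
  refine h.eq_zero_of_columns (q := q) (List.nodup_finRange _) List.mem_finRange
    (fun C₁ c C₂ e => ⟨?_, fun i => ?_⟩) hd
  · exact (hL c).nodup_iff.2 ((List.nodup_finRange _).filter _)
  · rw [(hL c).mem_iff, mem_iff_lt_of_finRange_eq_append e]
    simp

/-- With the two indices of each pair exchanged, rows from bottom to top become columns in
decreasing order of the index, each visiting exactly the columns before it. -/
theorem rigid_map_of_mem_rowOrderings (q : Equiv.Perm (Fin π.length))
    {O : List (Fin π.length × Fin π.length)} (hO : O ∈ rowOrderings π.length) :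
    Rigid (O.map fun p => sortPair (q p.1) (q p.2)) := by
  obtain ⟨L, hL, rfl⟩ := hO
  intro A A' h hd
  replace h := h.of_map (g := fun p : Fin π.length × Fin π.length => (q p.2, q p.1)) fun p => (sortPair_eq_or _ _).symm
  rw [List.map_flatMap] at h
  simp only [List.map_map, Function.comp_def] at h
  refine h.eq_zero_of_columns (q := q) (List.nodup_reverse.2 (List.nodup_finRange _))
    (by simp) (fun C₁ c C₂ e => ⟨?_, fun i => ?_⟩) hd
  · exact (hL c).nodup_iff.2 ((List.nodup_finRange _).filter _)
  · rw [(hL c).mem_iff, mem_iff_gt_of_reverse_finRange_eq_append e]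
    simp

theorem rigid_map_of_mem_serialOrderings (q : Equiv.Perm (Fin π.length))
    {O : List (Fin π.length × Fin π.length)} (hO : O ∈ serialOrderings π.length) :
    Rigid (O.map fun p => sortPair (q p.1) (q p.2)) := by
  rcases hO with h | h | h | h
  · exact rigid_map_of_mem_colOrderings q h
  · exact .of_reverse (by rw [← List.map_reverse]; exact rigid_map_of_mem_colOrderings q h)
  · exact rigid_map_of_mem_rowOrderings q h
  · exact .of_reverse (by rw [← List.map_reverse]; exact rigid_map_of_mem_rowOrderings q h)

/-! ### Annihilators as operators on vectors -/

theorem vec_unvec (a : OffPos π → ℂ) : vec (unvec a) = a := by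
  funext p
  simp [vec, unvec, p.2]

theorem unvec_zeroDiag (a : OffPos π → ℂ) : ZeroDiag (unvec a) := by
  intro s t h
  simp [unvec, h]

theorem annihilator_mulVec (i j : Fin π.length) (U : Matrix (Pos π) (Pos π) ℂ)
    (a : OffPos π → ℂ) :
    annihilator i j U *ᵥ a = vec (killBlocks i j (Uᴴ * unvec a * U)) := by
  rw [annihilator, LinearMap.toMatrix'_mulVec]
  rfl

/-- The squared Frobenius norm. -/
noncomputable def frobSq (A : Matrix (Pos π) (Pos π) ℂ) : ℝ :=
  ∑ p : Pos π × Pos π, ‖A p.1 p.2‖ ^ 2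

theorem frobSq_eq_trace (A : Matrix (Pos π) (Pos π) ℂ) :
    (frobSq A : ℂ) = (Aᴴ * A).trace := by
  simp only [frobSq, Matrix.trace, Matrix.diag, Matrix.mul_apply, Matrix.conjTranspose_apply,
    Fintype.sum_prod_type, Complex.ofReal_sum]
  rw [Finset.sum_comm]
  refine Finset.sum_congr rfl fun t _ => Finset.sum_congr rfl fun s _ => ?_
  rw [Complex.ofReal_pow, ← Complex.conj_mul']
  rfl

theorem frobSq_conj {U : Matrix (Pos π) (Pos π) ℂ} (hU : U ∈ Matrix.unitaryGroup (Pos π) ℂ)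
    (A : Matrix (Pos π) (Pos π) ℂ) : frobSq (Uᴴ * A * U) = frobSq A := by
  have hUU : U * Uᴴ = 1 := Unitary.mul_star_self_of_mem hU
  have : ((frobSq (Uᴴ * A * U) : ℝ) : ℂ) = (frobSq A : ℂ) := by
    rw [frobSq_eq_trace, frobSq_eq_trace]
    have e : (Uᴴ * A * U)ᴴ * (Uᴴ * A * U) = Uᴴ * (Aᴴ * A * U) := by
      simp only [Matrix.conjTranspose_mul, Matrix.conjTranspose_conjTranspose, Matrix.mul_assoc]
      rw [← Matrix.mul_assoc U Uᴴ, hUU, Matrix.one_mul]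
    rw [e, Matrix.trace_mul_comm, Matrix.mul_assoc, hUU, Matrix.mul_one]
  exact_mod_cast this

theorem frobSq_unvec (a : OffPos π → ℂ) : frobSq (unvec a) = ‖WithLp.toLp 2 a‖ ^ 2 := by
  rw [EuclideanSpace.norm_sq_eq, frobSq,
    ← Fintype.sum_subtype_add_sum_subtype (fun p : Pos π × Pos π => p.1.1 ≠ p.2.1),
    Finset.sum_eq_zero (f := fun p : {p : Pos π × Pos π // ¬ p.1.1 ≠ p.2.1} => _), add_zero]
  · exact Finset.sum_congr rfl fun p _ => by simp [unvec, p.2]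
  · intro p _
    rw [unvec_zeroDiag a _ _ (not_not.1 p.2), norm_zero, zero_pow two_ne_zero]

theorem unvec_vec_killBlocks_apply (i j : Fin π.length) (B : Matrix (Pos π) (Pos π) ℂ)
    (s t : Pos π) : unvec (vec (killBlocks i j B)) s t =
      if s.1 = t.1 ∨ (s.1 = i ∧ t.1 = j) ∨ (s.1 = j ∧ t.1 = i) then 0 else B s t := by
  by_cases h : s.1 = t.1
  · simp [unvec, h]
  · simp [unvec, vec, killBlocks, h]

theorem norm_unvec_vec_killBlocks_le (i j : Fin π.length) (B : Matrix (Pos π) (Pos π) ℂ)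
    (s t : Pos π) : ‖unvec (vec (killBlocks i j B)) s t‖ ^ 2 ≤ ‖B s t‖ ^ 2 := by
  rw [unvec_vec_killBlocks_apply]
  split_ifs
  · simp
  · exact le_rfl

theorem norm_annihilator_mulVec_le (i j : Fin π.length) {U : Matrix (Pos π) (Pos π) ℂ}
    (hU : U ∈ Matrix.unitaryGroup (Pos π) ℂ) (a : OffPos π → ℂ) :
    ‖WithLp.toLp 2 (annihilator i j U *ᵥ a)‖ ≤ ‖WithLp.toLp 2 a‖ := by
  rw [← sq_le_sq₀ (norm_nonneg _) (norm_nonneg _), ← frobSq_unvec, ← frobSq_unvec,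
    ← frobSq_conj hU (unvec a), annihilator_mulVec]
  exact Finset.sum_le_sum fun p _ => norm_unvec_vec_killBlocks_le i j _ _ _

/-- If an annihilator does not decrease the norm, nothing was annihilated. -/
theorem losslessStep_of_norm_le {i j : Fin π.length} {U : Matrix (Pos π) (Pos π) ℂ}
    (hU : U ∈ Matrix.unitaryGroup (Pos π) ℂ) (he : IsElementary i j U)
    (hi : (block U i i).det ≠ 0) (hj : (block U j j).det ≠ 0) {a : OffPos π → ℂ}
    (h : ‖WithLp.toLp 2 a‖ ≤ ‖WithLp.toLp 2 (annihilator i j U *ᵥ a)‖) :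
    LosslessStep i j (unvec a) (unvec (annihilator i j U *ᵥ a)) := by
  rw [← sq_le_sq₀ (norm_nonneg _) (norm_nonneg _), ← frobSq_unvec, ← frobSq_unvec,
    ← frobSq_conj hU (unvec a)] at h
  rw [annihilator_mulVec] at h ⊢
  set B := Uᴴ * unvec a * U with hB
  have hle : ∀ p ∈ (Finset.univ : Finset (Pos π × Pos π)),
      ‖unvec (vec (killBlocks i j B)) p.1 p.2‖ ^ 2 ≤ ‖B p.1 p.2‖ ^ 2 :=
    fun p _ => norm_unvec_vec_killBlocks_le i j _ _ _
  -- Termwise inequality with equal sums forces termwise equality, so every deleted entry was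
  -- already zero.
  have heq := (Finset.sum_eq_sum_iff_of_le hle).1 (le_antisymm (Finset.sum_le_sum hle) h)
  refine ⟨U, hU, he, hi, hj, ?_, fun s t hs ht => ?_⟩
  · rw [← hB]
    ext s t
    have hst := heq (s, t) (Finset.mem_univ _)
    simp only [unvec_vec_killBlocks_apply] at hst ⊢
    split_ifs at hst ⊢
    · simpa [eq_comm (a := (0 : ℝ)), eq_comm (a := (0 : ℂ))] using hst
    · rfl
  · rw [unvec_vec_killBlocks_apply, if_pos]
    rcases hs with hs | hs <;> rcases ht with ht | ht <;> simp [hs, ht]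

/-! ### Commuting annihilators -/

/-- `U - 1` and `V - 1` live on disjoint sets of block indices, so their products in both orders
vanish, and the commutator of `U` and `V` is that of `U - 1` and `V - 1`. -/
theorem IsElementary.mul_comm {i j k l : Fin π.length} {U V : Matrix (Pos π) (Pos π) ℂ}
    (hU : IsElementary i j U) (hV : IsElementary k l V) (hd : DisjointPairs (i, j) (k, l)) :
    U * V = V * U := by
  have key : ∀ {i j k l : Fin π.length} {U V : Matrix (Pos π) (Pos π) ℂ},
      IsElementary i j U → IsElementary k l V → DisjointPairs (i, j) (k, l) →
      (U - 1) * (V - 1) = 0 := by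
    intro i j k l U V hU hV hd
    obtain ⟨h1, h2, h3, h4⟩ := hd
    simp only at h1 h2 h3 h4
    ext s t
    rw [Matrix.mul_apply]
    refine Finset.sum_eq_zero fun x _ => ?_
    by_cases hx : x.1 = i ∨ x.1 = j
    · rw [Matrix.sub_apply V, hV x t (by rintro ⟨h | h, -⟩ <;> rw [h] at hx <;> tauto), sub_self, mul_zero]
    · rw [Matrix.sub_apply U, hU s x (by tauto), sub_self, zero_mul]
  have hd' : DisjointPairs (k, l) (i, j) := ⟨hd.1.symm, hd.2.2.1.symm, hd.2.1.symm, hd.2.2.2.symm⟩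
  have h1 := key hU hV hd
  have h2 := key hV hU hd'
  have e : U * V - V * U = (U - 1) * (V - 1) - (V - 1) * (U - 1) := by noncomm_ring
  rw [← sub_eq_zero, e, h1, h2, sub_zero]

/-- Blocks `(k, l)` and `(l, k)` are left unchanged by the similarity and contribute to no other
block. -/
theorem IsElementary.conj_killBlocks {i j k l : Fin π.length} {U : Matrix (Pos π) (Pos π) ℂ}
    (hU : IsElementary i j U) (hd : DisjointPairs (i, j) (k, l))
    (B : Matrix (Pos π) (Pos π) ℂ) :
    Uᴴ * killBlocks k l B * U = killBlocks k l (Uᴴ * B * U) := by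
  obtain ⟨h1, h2, h3, h4⟩ := hd
  simp only at h1 h2 h3 h4
  ext s t
  simp only [killBlocks, Matrix.of_apply]
  split_ifs with hst
  · have hs : s.1 ≠ i ∧ s.1 ≠ j := by
      rcases hst with ⟨hs, -⟩ | ⟨hs, -⟩ <;> rw [hs] <;> exact ⟨by tauto, by tauto⟩
    have ht : t.1 ≠ i ∧ t.1 ≠ j := by
      rcases hst with ⟨-, hs⟩ | ⟨-, hs⟩ <;> rw [hs] <;> exact ⟨by tauto, by tauto⟩
    rw [hU.conj_apply_of_notMem _ hs ht, Matrix.of_apply, if_pos hst]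
  · simp only [Matrix.mul_apply, Finset.sum_mul, Matrix.of_apply, Matrix.conjTranspose_apply]
    refine Finset.sum_congr rfl fun y _ => Finset.sum_congr rfl fun x _ => ?_
    split_ifs with hxy
    · rw [mul_zero, zero_mul]
      by_cases hxs : x = s
      · by_cases hyt : y = t
        · exact absurd (hxs ▸ hyt ▸ hxy) hst
        · rw [hU.apply_eq_zero hyt, mul_zero]
          rintro ⟨h | h, -⟩ <;> rw [h] at hxy <;> tauto
      · rw [hU.apply_eq_zero hxs, star_zero, zero_mul, zero_mul]
        rintro ⟨h | h, -⟩ <;> rw [h] at hxy <;> tauto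
    · rfl

theorem killBlocks_comm (i j k l : Fin π.length) (B : Matrix (Pos π) (Pos π) ℂ) :
    killBlocks i j (killBlocks k l B) = killBlocks k l (killBlocks i j B) := by
  ext s t
  simp only [killBlocks, Matrix.of_apply]
  split_ifs <;> rfl

theorem annihilator_mul_comm {i j k l : Fin π.length} {U V : Matrix (Pos π) (Pos π) ℂ}
    (hU : IsElementary i j U) (hV : IsElementary k l V) (hd : DisjointPairs (i, j) (k, l)) :
    annihilator i j U * annihilator k l V = annihilator k l V * annihilator i j U := by
  have hd' : DisjointPairs (k, l) (i, j) := ⟨hd.1.symm, hd.2.2.1.symm, hd.2.1.symm, hd.2.2.2.symm⟩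
  refine Matrix.ext_of_mulVec_single fun p => ?_
  -- Each basis vector is written as `vec` of a matrix, so that the second annihilator can be
  -- applied to a matrix whose diagonal blocks need not be zero.
  rw [← vec_unvec (Pi.single p 1), ← Matrix.mulVec_mulVec, ← Matrix.mulVec_mulVec,
    annihilator_mulVec_vec _ _ _ hV, annihilator_mulVec_vec _ _ _ hU,
    annihilator_mulVec_vec _ _ _ hU, annihilator_mulVec_vec _ _ _ hV,
    hU.conj_killBlocks hd, hV.conj_killBlocks hd', killBlocks_comm]
  have hc := hU.mul_comm hV hd
  have hc' : Vᴴ * Uᴴ = Uᴴ * Vᴴ := by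
    rw [← Matrix.conjTranspose_mul, ← Matrix.conjTranspose_mul, hc]
  congr 3
  calc Uᴴ * (Vᴴ * unvec (Pi.single p 1) * V) * U
      = Uᴴ * Vᴴ * unvec (Pi.single p 1) * (V * U) := by simp only [Matrix.mul_assoc]
    _ = Vᴴ * (Uᴴ * unvec (Pi.single p 1) * U) * V := by
      rw [← hc, ← hc']
      simp only [Matrix.mul_assoc]

/-! ### Sets of ordered products -/

/-- All products `x_{k-1} ⋯ x_1 x_0` with `x_r` in the set assigned to the `r`-th list entry. -/
def products {α M : Type*} [Monoid M] (K : α → Set M) : List α → Set M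
  | [] => 1
  | p :: l => products K l * K p

theorem products_append {α M : Type*} [Monoid M] (K : α → Set M) (l₁ l₂ : List α) :
    products K (l₁ ++ l₂) = products K l₂ * products K l₁ := by
  induction l₁ with
  | nil => simp [products]
  | cons p l ih => rw [List.cons_append, products, products, ih, mul_assoc]

theorem isCompact_products {α M : Type*} [Monoid M] [TopologicalSpace M] [ContinuousMul M]
    {K : α → Set M} (hK : ∀ p, IsCompact (K p)) (l : List α) : IsCompact (products K l) := by
  induction l with
  | nil => exact isCompact_singleton
  | cons p l ih => exact ih.mul (hK p)

theorem prod_mem_pow_length {M : Type*} [Monoid M] {S : Set M} {l : List M}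
    (h : ∀ x ∈ l, x ∈ S) : l.prod ∈ S ^ l.length := by
  induction l with
  | nil => simp
  | cons x l ih =>
    rw [List.prod_cons, List.length_cons, pow_succ']
    exact Set.mul_mem_mul (h x List.mem_cons_self) (ih fun y hy => h y (List.mem_cons_of_mem _ hy))

/-- With `b * a` a sweep of `O₁ ++ O₂`, this exhibits `k` sweeps of the shifted ordering inside `k +
1` sweeps. -/
theorem mul_pow_succ_swap {M : Type*} [Monoid M] (a b : M) (k : ℕ) :
    (b * a) ^ (k + 1) = b * (a * b) ^ k * a := by
  induction k with
  | zero => simp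
  | succ k ih => rw [pow_succ, ih, pow_succ (a * b) k]; simp only [mul_assoc]

section WeakChain

variable {m : ℕ} {M : Type*} [Monoid M] {K : Fin m × Fin m → Set M}

theorem Equivalent.products_eq
    (hcomm : ∀ p q, DisjointPairs p q → K p * K q = K q * K p)
    {O O' : List (Fin m × Fin m)} (h : Equivalent O O') : products K O = products K O' := by
  induction h with
  | refl => rfl
  | tail _ h ih =>
    obtain ⟨l₁, l₂, p, q, hd, rfl, rfl⟩ := h
    rw [ih, products_append, products_append]
    simp only [products, mul_assoc]
    rw [← mul_assoc (K q), ← mul_assoc (K p), hcomm p q hd]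

theorem products_subset_submonoid (B : Submonoid M) (hB : ∀ p, K p ⊆ B)
    (l : List (Fin m × Fin m)) : products K l ⊆ B := by
  induction l with
  | nil => simp [products]
  | cons p l ih =>
    rintro _ ⟨x, hx, y, hy, rfl⟩
    exact B.mul_mem (ih hx) (hB p hy)

/-- Along a weak chain with `d` shifts, `d + 1` sweeps contain a full sweep of the other
ordering. -/
theorem WeakChain.products_pow_subset
    (hcomm : ∀ p q, DisjointPairs p q → K p * K q = K q * K p)
    (B : Submonoid M) (hB : ∀ p, K p ⊆ B) {d : ℕ} {O O' : List (Fin m × Fin m)}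
    (h : WeakChain d O O') :
    products K O ^ (d + 1) ⊆ (B : Set M) * products K O' * B := by
  induction h with
  | nil O =>
    intro x hx
    rw [zero_add, pow_one] at hx
    exact ⟨1 * x, ⟨1, B.one_mem, x, hx, rfl⟩, 1, B.one_mem, by simp⟩
  | equiv h _ ih => rwa [h.products_eq hcomm]
  | shift h _ ih =>
    obtain ⟨O₁, O₂, rfl, rfl⟩ := h
    rw [products_append] at ih ⊢
    rw [mul_pow_succ_swap]
    -- The two partial sweeps left over by the shift are absorbed into `B`.
    refine (Set.mul_subset_mul (Set.mul_subset_mul (products_subset_submonoid B hB O₂) ih)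
      (products_subset_submonoid B hB O₁)).trans ?_
    rintro _ ⟨_, ⟨b, hb, _, ⟨_, ⟨c, hc, x, hx, rfl⟩, e, he, rfl⟩, rfl⟩, f, hf, rfl⟩
    exact ⟨b * c * x, ⟨b * c, B.mul_mem hb hc, x, hx, rfl⟩, e * f, B.mul_mem he hf,
      by simp only [mul_assoc]⟩

end WeakChain

/-! ### Relabelling -/

section Relabel

variable {m : ℕ}

/-- The relabelling of pivot pairs by a permutation. -/
def relabel (q : Equiv.Perm (Fin m)) (p : Fin m × Fin m) : Fin m × Fin m :=
  sortPair (q p.1) (q p.2)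

/-- Sorting forgets which index came first, so only increasing pairs are recovered. -/
theorem relabel_symm_relabel (q : Equiv.Perm (Fin m)) {p : Fin m × Fin m} (hp : p.1 < p.2) :
    relabel q.symm (relabel q p) = p := by
  unfold relabel
  rcases sortPair_eq_or (q p.1) (q p.2) with h | h <;> rw [h] <;>
    simp [sortPair, hp.le]

theorem DisjointPairs.relabel (q : Equiv.Perm (Fin m)) {p r : Fin m × Fin m}
    (h : DisjointPairs p r) : DisjointPairs (relabel q p) (relabel q r) := by
  obtain ⟨h1, h2, h3, h4⟩ := h
  unfold BlockJacobi.relabel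
  rcases sortPair_eq_or (q p.1) (q p.2) with h | h <;>
    rcases sortPair_eq_or (q r.1) (q r.2) with h' | h' <;>
    simp [DisjointPairs, h, h', h1, h2, h3, h4]

theorem Equivalent.relabel (q : Equiv.Perm (Fin m)) {O O' : List (Fin m × Fin m)}
    (h : Equivalent O O') :
    Equivalent (O.map (BlockJacobi.relabel q)) (O'.map (BlockJacobi.relabel q)) := by
  refine Relation.ReflTransGen.lift (p := AdmissibleTransposition) _ ?_ _ _ h
  rintro _ _ ⟨l₁, l₂, p, r, hd, rfl, rfl⟩
  exact ⟨l₁.map (BlockJacobi.relabel q), l₂.map (BlockJacobi.relabel q), _, _, hd.relabel q,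
    by simp, by simp⟩

theorem WeakChain.relabel (q : Equiv.Perm (Fin m)) {d : ℕ} {O O' : List (Fin m × Fin m)}
    (h : WeakChain d O O') :
    WeakChain d (O.map (BlockJacobi.relabel q)) (O'.map (BlockJacobi.relabel q)) := by
  induction h with
  | nil O => exact .nil _
  | equiv h _ ih => exact .equiv (h.relabel q) ih
  | shift h _ ih =>
    obtain ⟨O₁, O₂, rfl, rfl⟩ := h
    exact .shift ⟨_, _, List.map_append, List.map_append⟩ ih

theorem Equivalent.perm {O O' : List (Fin m × Fin m)} (h : Equivalent O O') : O.Perm O' := by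
  induction h with
  | refl => exact .refl _
  | tail _ h ih =>
    obtain ⟨l₁, l₂, p, q, -, rfl, rfl⟩ := h
    exact ih.trans ((List.Perm.swap q p l₂).append_left l₁)

theorem WeakChain.perm {d : ℕ} {O O' : List (Fin m × Fin m)} (h : WeakChain d O O') :
    O.Perm O' := by
  induction h with
  | nil O => exact .refl _
  | equiv h _ ih => exact h.perm.trans ih
  | shift h _ ih =>
    obtain ⟨O₁, O₂, rfl, rfl⟩ := h
    exact List.perm_append_comm.trans ih

theorem map_relabel_symm_map_relabel (q : Equiv.Perm (Fin m)) {O : List (Fin m × Fin m)}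
    (hO : ∀ p ∈ O, p.1 < p.2) : (O.map (relabel q)).map (relabel q.symm) = O := by
  rw [List.map_map]
  exact (List.map_congr_left fun p hp => relabel_symm_relabel q (hO p hp)).trans (List.map_id' O)

/-- The permutation equivalence in a chain in canonical form can be moved to its end. -/
theorem CanonicalChain.exists_weakChain {d : ℕ} {O O'' : List (Fin m × Fin m)}
    (hO : IsPivotOrdering O) (h : CanonicalChain d O O'') :
    ∃ q : Equiv.Perm (Fin m), WeakChain d O (O''.map (BlockJacobi.relabel q)) := by
  rcases h with ⟨_, ⟨q, rfl⟩, h⟩ | ⟨O', h, q, rfl⟩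
  -- The inverse permutation is applied to the whole weak chain, which takes its start back to `O`.
  · refine ⟨q.symm, ?_⟩
    have := h.relabel q.symm
    rwa [show (O.map fun p => sortPair (q p.1) (q p.2)) = O.map (BlockJacobi.relabel q) from rfl,
      map_relabel_symm_map_relabel q fun p hp => (hO.2 p).1 hp] at this
  · refine ⟨q.symm, ?_⟩
    rwa [show (O'.map fun p => sortPair (q p.1) (q p.2)) = O'.map (BlockJacobi.relabel q) from rfl,
      map_relabel_symm_map_relabel q fun p hp => (hO.2 p).1 (h.perm.mem_iff.2 hp)]

end Relabel

/-! ### A compact class of transformations -/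

/-- Unitary elementary matrices whose diagonal pivot blocks have determinant at least `c` in
absolute value. -/
def detClass (π : Composition n) (c : ℝ) (p : Fin π.length × Fin π.length) :
    Set (Matrix (Pos π) (Pos π) ℂ) :=
  {U | U ∈ Matrix.unitaryGroup (Pos π) ℂ ∧ IsElementary p.1 p.2 U ∧
    c ≤ ‖(block U p.1 p.1).det‖ ∧ c ≤ ‖(block U p.2 p.2).det‖}

/-- The modulus of the determinant is the product of the singular values. For `k = 0` both sides are
`1`. -/
theorem sigmaMin_pow_le_norm_det {k : ℕ} (X : Matrix (Fin k) (Fin k) ℂ) :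
    sigmaMin X ^ k ≤ ‖X.det‖ := by
  have h : ‖X.det‖ = ∏ i ∈ Finset.range k, (Matrix.toEuclideanLin X).singularValues i := by
    have h1 := (Matrix.toEuclideanLin X).normDet_eq_prod_singularValues
    rw [LinearMap.normDet_eq_norm_det, Matrix.toEuclideanLin_eq_toLin_orthonormal,
      LinearMap.det_toLin, finrank_euclideanSpace_fin] at h1
    rw [h1, Matrix.toEuclideanLin_eq_toLin_orthonormal]
  rw [h]
  calc sigmaMin X ^ k = ∏ _i ∈ Finset.range k, sigmaMin X := by simp
    _ ≤ _ := Finset.prod_le_prod (fun _ _ => LinearMap.singularValues_nonneg _ _) fun i hi =>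
      LinearMap.singularValues_antitone _ (Nat.le_sub_one_of_lt (Finset.mem_range.1 hi))

theorem gammaConst_pos (a b : ℕ) : 0 < gammaConst a b := by
  refine lt_max_of_lt_right (div_pos one_pos (Real.sqrt_pos.2 ?_))
  exact_mod_cast Nat.choose_pos (Nat.le_add_right a b)

theorem exists_ubce_subset_detClass (π : Composition n) {ρ : ℝ} (hρ : 0 < ρ) :
    ∃ c > 0, ∀ p : Fin π.length × Fin π.length, ubce π ρ p.1 p.2 ⊆ detClass π c p := by
  have hp : ∀ p : Fin π.length × Fin π.length, ∃ c > 0, ubce π ρ p.1 p.2 ⊆ detClass π c p := by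
    intro p
    set δ := ρ * gammaConst (π.blocksFun p.1) (π.blocksFun p.2) with hδ
    have hδ0 : 0 < δ := mul_pos hρ (gammaConst_pos _ _)
    refine ⟨min (δ ^ π.blocksFun p.1) (δ ^ π.blocksFun p.2), by positivity, ?_⟩
    rintro U ⟨hU, he, heq, hle⟩
    refine ⟨hU, he, (min_le_left _ _).trans ?_, (min_le_right _ _).trans ?_⟩
    · exact (pow_le_pow_left₀ hδ0.le hle _).trans (sigmaMin_pow_le_norm_det _)
    · exact (pow_le_pow_left₀ hδ0.le (heq ▸ hle) _).trans (sigmaMin_pow_le_norm_det _)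
  choose c hc hsub using hp
  -- There are finitely many pairs, so one bound serves all; `1` is a dummy value when there are
  -- none.
  obtain ⟨b, hb0, hb⟩ : ∃ b > 0, ∀ p, b ≤ c p := by
    rcases isEmpty_or_nonempty (Fin π.length × Fin π.length) with h | h
    · exact ⟨1, one_pos, fun p => h.elim p⟩
    · obtain ⟨p, hp⟩ := Finite.exists_min c
      exact ⟨c p, hc p, hp⟩
  exact ⟨b, hb0, fun p U hU => ⟨(hsub p hU).1, (hsub p hU).2.1, (hb p).trans (hsub p hU).2.2.1,
    (hb p).trans (hsub p hU).2.2.2⟩⟩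

theorem norm_le_one_of_mem_unitaryGroup {ι : Type*} [Fintype ι] [DecidableEq ι]
    {U : Matrix ι ι ℂ} (hU : U ∈ Matrix.unitaryGroup ι ℂ) : ‖U‖ ≤ 1 := by
  rcases subsingleton_or_nontrivial (Matrix ι ι ℂ) with h | h
  · rw [Subsingleton.elim U 0, norm_zero]
    exact zero_le_one
  · exact (CStarRing.norm_of_mem_unitary hU).le

/-- The conditions are closed because the determinants are polynomials in the entries, and unitary
matrices are bounded. -/
theorem isCompact_detClass (π : Composition n) (c : ℝ) (p : Fin π.length × Fin π.length) :
    IsCompact (detClass π c p) := by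
  have : ProperSpace (Matrix (Pos π) (Pos π) ℂ) := FiniteDimensional.proper ℂ _
  refine Metric.isCompact_of_isClosed_isBounded ?_ ?_
  · have hent : ∀ s t : Pos π, Continuous fun U : Matrix (Pos π) (Pos π) ℂ => U s t :=
      fun s t => continuous_id.matrix_elem s t
    have hdet : ∀ r : Fin π.length,
        Continuous fun U : Matrix (Pos π) (Pos π) ℂ => ‖(block U r r).det‖ := fun r =>
      (Continuous.matrix_det (continuous_matrix fun x y => hent _ _)).norm
    have helem : IsClosed {U : Matrix (Pos π) (Pos π) ℂ | IsElementary p.1 p.2 U} := by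
      simp only [IsElementary, Set.ofPred_forall]
      exact isClosed_iInter fun s => isClosed_iInter fun t => isClosed_iInter fun _ =>
        isClosed_eq (hent s t) continuous_const
    exact isClosed_unitary.inter (helem.inter ((isClosed_le continuous_const (hdet _)).inter
      (isClosed_le continuous_const (hdet _))))
  · refine (Metric.isBounded_closedBall (x := 0) (r := 1)).subset fun U hU => ?_
    rw [mem_closedBall_zero_iff]
    exact norm_le_one_of_mem_unitaryGroup hU.1

/-- The annihilators of transformations from `detClass`. -/
def detAnnihilators (π : Composition n) (c : ℝ) (p : Fin π.length × Fin π.length) :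
    Set (Matrix (OffPos π) (OffPos π) ℂ) :=
  annihilator p.1 p.2 '' detClass π c p

theorem continuous_annihilator (i j : Fin π.length) :
    Continuous (annihilator i j : Matrix (Pos π) (Pos π) ℂ → _) := by
  refine continuous_matrix fun p r => ?_
  simp only [annihilator, LinearMap.toMatrix'_apply, annihilatorMap, LinearMap.coe_mk,
    AddHom.coe_mk, vec, killBlocks, Matrix.of_apply]
  split_ifs
  · exact continuous_const
  · exact ((continuous_id.matrix_conjTranspose.matrix_mul continuous_const).matrix_mul
      continuous_id).matrix_elem _ _

theorem isCompact_detAnnihilators (π : Composition n) (c : ℝ)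
    (p : Fin π.length × Fin π.length) : IsCompact (detAnnihilators π c p) :=
  (isCompact_detClass π c p).image (continuous_annihilator p.1 p.2)

theorem detAnnihilators_mul_comm (π : Composition n) (c : ℝ)
    (p q : Fin π.length × Fin π.length) (hd : DisjointPairs p q) :
    detAnnihilators π c p * detAnnihilators π c q
      = detAnnihilators π c q * detAnnihilators π c p := by
  have key : ∀ U ∈ detClass π c p, ∀ V ∈ detClass π c q,
      annihilator p.1 p.2 U * annihilator q.1 q.2 V
        = annihilator q.1 q.2 V * annihilator p.1 p.2 U :=
    fun U hU V hV => annihilator_mul_comm hU.2.1 hV.2.1 hd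
  ext R
  constructor
  · rintro ⟨_, ⟨U, hU, rfl⟩, _, ⟨V, hV, rfl⟩, rfl⟩
    exact ⟨_, ⟨V, hV, rfl⟩, _, ⟨U, hU, rfl⟩, (key U hU V hV).symm⟩
  · rintro ⟨_, ⟨V, hV, rfl⟩, _, ⟨U, hU, rfl⟩, rfl⟩
    exact ⟨_, ⟨U, hU, rfl⟩, _, ⟨V, hV, rfl⟩, key U hU V hV⟩

theorem norm_le_of_forall_mulVec {ι : Type*} [Fintype ι] [DecidableEq ι] {R : Matrix ι ι ℂ}
    {C : ℝ} (hC : 0 ≤ C)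
    (h : ∀ a : ι → ℂ, ‖WithLp.toLp 2 (R *ᵥ a)‖ ≤ C * ‖WithLp.toLp 2 a‖) : ‖R‖ ≤ C := by
  rw [← Matrix.l2_opNorm_toEuclideanCLM]
  exact ContinuousLinearMap.opNorm_le_bound _ hC fun x => h x.ofLp

theorem norm_mulVec_le {ι : Type*} [Fintype ι] [DecidableEq ι] (R : Matrix ι ι ℂ) (a : ι → ℂ) :
    ‖WithLp.toLp 2 (R *ᵥ a)‖ ≤ ‖R‖ * ‖WithLp.toLp 2 a‖ :=
  R.l2_opNorm_mulVec (WithLp.toLp 2 a)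

/-- The matrices of spectral norm at most `1`. -/
def contractions (ι : Type*) [Fintype ι] [DecidableEq ι] : Submonoid (Matrix ι ι ℂ) where
  carrier := {R | ‖R‖ ≤ 1}
  one_mem' := norm_le_one_of_mem_unitaryGroup (one_mem _)
  mul_mem' {R S} hR hS := (norm_mul_le R S).trans (mul_le_one₀ hR (norm_nonneg _) hS)

theorem detAnnihilators_subset (π : Composition n) (c : ℝ) (p : Fin π.length × Fin π.length) :
    detAnnihilators π c p ⊆ contractions (OffPos π) := by
  rintro _ ⟨U, hU, rfl⟩
  refine norm_le_of_forall_mulVec zero_le_one fun a => ?_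
  rw [one_mul]
  exact norm_annihilator_mulVec_le p.1 p.2 hU.1 a

theorem ubceOperators_subset {ρ c : ℝ}
    (h : ∀ p : Fin π.length × Fin π.length, ubce π ρ p.1 p.2 ⊆ detClass π c p)
    (O : List (Fin π.length × Fin π.length)) :
    ubceOperators π ρ O ⊆ products (detAnnihilators π c) O := by
  rintro _ ⟨Rs, hRs, rfl⟩
  induction hRs with
  | nil => simp [products]
  | cons hR _ ih =>
    obtain ⟨U, hU, rfl⟩ := hR
    rw [List.reverse_cons, List.prod_append, List.prod_singleton]
    exact Set.mul_mem_mul ih ⟨U, h _ hU, rfl⟩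

/-! ### Strict contraction -/

/-- All factors are contractions, so if the product does not shrink `a`, then no factor shrinks the
vector it receives. -/
theorem losslessSweep_of_norm_le {c : ℝ} (hc : 0 < c)
    {O : List (Fin π.length × Fin π.length)} {J : Matrix (OffPos π) (OffPos π) ℂ}
    (hJ : J ∈ products (detAnnihilators π c) O) {a : OffPos π → ℂ}
    (h : ‖WithLp.toLp 2 a‖ ≤ ‖WithLp.toLp 2 (J *ᵥ a)‖) :
    LosslessSweep O (unvec a) (unvec (J *ᵥ a)) := by
  induction O generalizing J a with
  | nil =>
    obtain rfl : J = 1 := hJ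
    rw [Matrix.one_mulVec]
    rfl
  | cons p l ih =>
    obtain ⟨J, hJ, _, ⟨U, hU, rfl⟩, rfl⟩ := hJ
    simp only [← Matrix.mulVec_mulVec] at h ⊢
    have h1 : ‖J‖ ≤ 1 := products_subset_submonoid (contractions (OffPos π))
      (detAnnihilators_subset π c) l hJ
    have h2 := norm_annihilator_mulVec_le p.1 p.2 hU.1 a
    have h3 := (norm_mulVec_le J (annihilator p.1 p.2 U *ᵥ a)).trans
      (mul_le_of_le_one_left (norm_nonneg _) h1)
    exact ⟨_, losslessStep_of_norm_le hU.1 hU.2.1 (norm_pos_iff.1 (hc.trans_le hU.2.2.1))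
      (norm_pos_iff.1 (hc.trans_le hU.2.2.2)) (h.trans h3), ih hJ (h2.trans h)⟩

/-- A compact set of matrices each of which strictly decreases the norm of every nonzero vector
has a uniform contraction constant. -/
theorem exists_norm_le_of_isCompact {ι : Type*} [Fintype ι] [DecidableEq ι]
    {T : Set (Matrix ι ι ℂ)} (hT : IsCompact T)
    (h : ∀ J ∈ T, ∀ a : ι → ℂ, ‖WithLp.toLp 2 a‖ ≤ ‖WithLp.toLp 2 (J *ᵥ a)‖ → a = 0) :
    ∃ μ : ℝ, 0 ≤ μ ∧ μ < 1 ∧ ∀ J ∈ T, ‖J‖ ≤ μ := by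
  have hS : IsCompact (T ×ˢ Metric.sphere (0 : EuclideanSpace ℂ ι) 1) :=
    hT.prod (isCompact_sphere _ _)
  have hcont : Continuous fun x : Matrix ι ι ℂ × EuclideanSpace ℂ ι =>
      ‖WithLp.toLp 2 (x.1 *ᵥ x.2.ofLp)‖ :=
    ((PiLp.continuous_toLp 2 _).comp (continuous_fst.matrix_mulVec
      ((PiLp.continuous_ofLp 2 _).comp continuous_snd))).norm
  have hunit : ∀ {J : Matrix ι ι ℂ} {C : ℝ}, 0 ≤ C →
      (∀ x ∈ Metric.sphere (0 : EuclideanSpace ℂ ι) 1, ‖WithLp.toLp 2 (J *ᵥ x.ofLp)‖ ≤ C) →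
      ‖J‖ ≤ C := by
    intro J C hC hJ
    rw [← Matrix.l2_opNorm_toEuclideanCLM]
    exact ContinuousLinearMap.opNorm_le_of_unit_norm hC fun x hx => hJ x (by simpa using hx)
  -- If `T` or the unit sphere is empty, the bound `0` works; otherwise the maximum of the norm over
  -- the compact product is attained, and is below `1` by strict decrease there.
  rcases (T ×ˢ Metric.sphere (0 : EuclideanSpace ℂ ι) 1).eq_empty_or_nonempty with he | hne
  · refine ⟨0, le_rfl, one_pos, fun J hJ => hunit le_rfl fun x hx => ?_⟩
    exact absurd (he ▸ Set.mk_mem_prod hJ hx) (Set.notMem_empty _)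
  · obtain ⟨⟨J₀, x₀⟩, ⟨hJ₀, hx₀⟩, hmax⟩ := hS.exists_isMaxOn hne hcont.continuousOn
    refine ⟨_, norm_nonneg (WithLp.toLp 2 (J₀ *ᵥ x₀.ofLp)), ?_, fun J hJ => ?_⟩
    · by_contra hge
      have hx1 : ‖x₀‖ = 1 := by simpa using hx₀
      have h0 : x₀ = 0 := by
        have := h J₀ hJ₀ x₀.ofLp (hx1.le.trans (not_lt.1 hge))
        ext i
        exact congrFun this i
      simp [h0] at hx1
    · exact hunit (norm_nonneg _) fun x hx =>
        isMaxOn_iff.1 hmax (J, x) (Set.mk_mem_prod hJ hx)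

/-- Only finitely many lists of pairs are free of repetitions, so the union over all rigid ones is
still compact and the constant does not depend on `O`. -/
theorem exists_norm_products_le (π : Composition n) {c : ℝ} (hc : 0 < c) :
    ∃ μ : ℝ, 0 ≤ μ ∧ μ < 1 ∧ ∀ O : List (Fin π.length × Fin π.length), O.Nodup → Rigid O →
      ∀ J ∈ products (detAnnihilators π c) O, ‖J‖ ≤ μ := by
  have hfin : {O : List (Fin π.length × Fin π.length) | O.Nodup ∧ Rigid O}.Finite :=
    (Set.finite_coe_iff.1 (Finite.of_fintype {O : List (Fin π.length × Fin π.length) // O.Nodup})).subset fun O h => h.1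
  obtain ⟨μ, h0, h1, hμ⟩ := exists_norm_le_of_isCompact
    (hfin.isCompact_biUnion fun O _ => isCompact_products (isCompact_detAnnihilators π c) O) (by
      intro J hJ a ha
      simp only [Set.mem_iUnion] at hJ
      obtain ⟨O, hO, hJ⟩ := hJ
      have := hO.2 _ _ (losslessSweep_of_norm_le hc hJ ha) (unvec_zeroDiag a)
      rw [← vec_unvec a, this]
      rfl)
  exact ⟨μ, h0, h1, fun O hn hr J hJ => hμ J (Set.mem_biUnion ⟨hn, hr⟩ hJ)⟩

theorem exists_contraction_constant (π : Composition n) {ρ : ℝ} (hρ : 0 < ρ) :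
    ∃ μ : ℝ, 0 ≤ μ ∧ μ < 1 ∧
      ∀ O ∈ generalizedSerialOrderings π.length, ∀ O'' ∈ serialOrderings π.length,
        ∀ d : ℕ, CanonicalChain d O O'' →
        ∀ J : Fin (d + 1) → Matrix (OffPos π) (OffPos π) ℂ,
          (∀ k, J k ∈ ubceOperators π ρ O) → ‖(List.ofFn J).reverse.prod‖ ≤ μ := by
  obtain ⟨c, hc, hsub⟩ := exists_ubce_subset_detClass π hρ
  obtain ⟨μ, h0, h1, hμ⟩ := exists_norm_products_le π hc
  refine ⟨μ, h0, h1, fun O hO O'' hO'' d hd J hJ => ?_⟩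
  obtain ⟨q, hq⟩ := hd.exists_weakChain hO.1
  have hmem := prod_mem_pow_length (S := products (detAnnihilators π c) O)
    (l := (List.ofFn J).reverse) fun x hx => by
      rw [List.mem_reverse, List.mem_ofFn] at hx
      obtain ⟨k, rfl⟩ := hx
      exact ubceOperators_subset hsub O (hJ k)
  rw [List.length_reverse, List.length_ofFn] at hmem
  obtain ⟨_, ⟨X, hX, R, hR, rfl⟩, Y, hY, hprod⟩ :=
    hq.products_pow_subset (detAnnihilators_mul_comm π c) (contractions (OffPos π))
      (detAnnihilators_subset π c) hmem
  rw [← hprod]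
  have hRμ := hμ _ (hq.perm.nodup_iff.1 hO.1.1) (rigid_map_of_mem_serialOrderings q hO'') R hR
  calc ‖X * R * Y‖ ≤ ‖X‖ * ‖R‖ * ‖Y‖ :=
        (norm_mul_le _ _).trans (mul_le_mul_of_nonneg_right (norm_mul_le _ _) (norm_nonneg _))
    _ ≤ ‖X‖ * ‖R‖ := mul_le_of_le_one_right (by positivity) hY
    _ ≤ ‖R‖ := mul_le_of_le_one_left (norm_nonneg _) hX
    _ ≤ μ := hRμ

end BlockJacobi

theorem mainTheorem3 :
    ∃ (μ : (n : ℕ) → Composition n → ℝ → ℝ) (μt : ℕ → ℝ → ℝ),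
      ∀ (n : ℕ) (π : Composition n) (ρ : ℝ), 0 < ρ → ρ ≤ 1 →
        0 ≤ μ n π ρ ∧ μ n π ρ < μt n ρ ∧ μt n ρ < 1 ∧
        ∀ O ∈ BlockJacobi.generalizedSerialOrderings π.length,
        ∀ O'' ∈ BlockJacobi.serialOrderings π.length,
        ∀ d : ℕ, BlockJacobi.CanonicalChain d O O'' →
        ∀ J : Fin (d + 1) →
            Matrix (BlockJacobi.OffPos π) (BlockJacobi.OffPos π) ℂ,
          (∀ k, J k ∈ BlockJacobi.ubceOperators π ρ O) →
            ‖(List.ofFn J).reverse.prod‖ ≤ μ n π ρ := by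
  choose! μ h0 h1 hμ using fun (n : ℕ) (π : Composition n) (ρ : ℝ) (hρ : 0 < ρ) =>
    BlockJacobi.exists_contraction_constant π hρ
  -- There are finitely many compositions of `n`; any number strictly between the largest of their
  -- constants and `1` serves as the bound.
  have hsup : ∀ (n : ℕ) (ρ : ℝ), 0 < ρ → ∃ b < 1, ∀ π : Composition n, μ n π ρ < b := by
    intro n ρ hρ
    obtain ⟨π₀, hπ₀⟩ := Finite.exists_max fun π : Composition n => μ n π ρ
    obtain ⟨b, hb, hb1⟩ := exists_between (h1 n π₀ ρ hρ)
    exact ⟨b, hb1, fun π => (hπ₀ π).trans_lt hb⟩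
  choose! μt ht1 ht using hsup
  exact ⟨μ, μt, fun n π ρ hρ _ => ⟨h0 n π ρ hρ, ht n ρ hρ π, ht1 n ρ hρ, hμ n π ρ hρ⟩⟩
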